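/- Let $\mathbb F$ be a finite field of characteristic $p$ and let $s_1,s_2\in\{0,1,\dots,p-1\}$. Fix a total order on the group $\mathbb Q\times\mathbb Q$ that is compatible with addition and for which $(1,0)$ and $(0,1)$ are positive (for example the lexicographic order). Let $\mathbb F((t_1^{\mathbb Q},t_2^{\mathbb Q}))$ be the field of generalized power series (Hahn series) $\sum_{(a,b)} f_{(a,b)}t_1^at_2^b$ with coefficients in $\mathbb F$ and well-ordered support in $\mathbb Q\times\mathbb Q$, and let $\mathbb F((t_1,t_2))\subset\mathbb F((t_1^{\mathbb Q},t_2^{\mathbb Q}))$ be the field of fractions of the power series ring $\mathbb F[[t_1,t_2]]$. Let $f\in\mathbb F((t_1^{\mathbb Q},t_2^{\mathbb Q}))$ be a series of the form $$f=\sum f_{\left(\frac{-s_1}{p^i},\frac{-s_2}{p^j}\right)}\,t_1^{-s_1/p^i}t_2^{-s_2/p^j},$$ that is, a series whose support is contained in $\{(-s_1/p^i,-s_2/p^j): i,j\in\mathbb Z_{>0}\}$; here $f_{(a,b)}$ denotes the coefficient of $t_1^at_2^b$ in $f$. Then $f$ is algebraic over $\mathbb F((t_1,t_2))$ if and only if both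 of the following conditions hold: 1. there are positive integers $M$ and $N$ such that for all $i_0,j_0\in\mathbb Z_{>0}$ the sequence $a_n=f_{(-s_1/p^{i_0+n},\,-s_2/p^{j_0+n})}$, $n\ge 0$, satisfies $a_{n+N}=a_n$ for all $n\ge M$; 2. for every $i\in\mathbb Z_{>0}$ the sequence $b_n=f_{(-s_1/p^{i},\,-s_2/p^{n})}$ is eventually periodic, and for every $j\in\mathbb Z_{>0}$ the sequence $c_n=f_{(-s_1/p^{n},\,-s_2/p^{j})}$ is eventually periodic. A sequence $(x_n)$ is called eventually periodic if there are integers $N>0$ and $M\ge 0$ with $x_{n+N}=x_n$ for all $n\ge M$. -/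

import Mathlib

/-!
Throughout, `Γ` is a linearly ordered abelian group and `e : ℚ × ℚ ≃+ Γ` an isomorphism of groups
that is monotone for the product order of `ℚ × ℚ`.  Such a pair is the same thing as a total group
order on `ℚ × ℚ` for which `(1, 0)` and `(0, 1)` are positive, for example the lexicographic order
(`Γ = ℚ ×ₗ ℚ`).  The Mathlib field `HahnSeries Γ F` is then the field `F((t₁^ℚ, t₂^ℚ))`, and
`f.coeff (e (a, b))` is the coefficient of `t₁ ^ a * t₂ ^ b` in `f`.
-/

namespace TwoVar

variable {Γ : Type*} [AddCommGroup Γ]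

/-- The exponent in `Γ` of the monomial `t₁ ^ (x 0) * t₂ ^ (x 1)`. -/
def expo (e : ℚ × ℚ ≃+ Γ) (x : Fin 2 →₀ ℕ) : Γ := e ((x 0 : ℚ), (x 1 : ℚ))

theorem expo_injective (e : ℚ × ℚ ≃+ Γ) : Function.Injective (expo e) := by
  intro x y h
  have h' := e.injective h
  simp only [Prod.mk.injEq, Nat.cast_inj] at h'
  ext i
  fin_cases i
  · exact h'.1
  · exact h'.2

theorem expo_add (e : ℚ × ℚ ≃+ Γ) (x y : Fin 2 →₀ ℕ) : expo e (x + y) = expo e x + expo e y := by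
  simp [expo, ← map_add]

variable [LinearOrder Γ] {F : Type*} [Field F]

theorem expo_monotone (e : ℚ × ℚ ≃+ Γ) (he : Monotone e) : Monotone (expo e) := by
  intro x y h
  exact he ⟨Nat.cast_le.2 (h 0), Nat.cast_le.2 (h 1)⟩

/-- A formal power series `∑ φ_{n,m} t₁ ^ n * t₂ ^ m`, read as a Hahn series. -/
noncomputable def ofMv (e : ℚ × ℚ ≃+ Γ) (he : Monotone e) (φ : MvPowerSeries (Fin 2) F) : HahnSeries Γ F where
  coeff := Function.extend (expo e) (fun x => MvPowerSeries.coeff x φ) 0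
  isPWO_support' := by
    have h : (Set.univ : Set (Fin 2 →₀ ℕ)).IsPWO := Set.isPWO_of_wellQuasiOrderedLE _
    refine (h.image_of_monotone (expo_monotone e he)).mono ?_
    intro γ hγ
    by_contra hn
    refine hγ (Function.extend_apply' _ _ _ ?_)
    rintro ⟨x, hx⟩
    exact hn ⟨x, trivial, hx⟩

theorem coeff_ofMv_expo (e : ℚ × ℚ ≃+ Γ) (he : Monotone e) (φ : MvPowerSeries (Fin 2) F)
    (x : Fin 2 →₀ ℕ) : (ofMv e he φ).coeff (expo e x) = MvPowerSeries.coeff x φ :=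
  (expo_injective e).extend_apply _ _ x

theorem coeff_ofMv_of_not (e : ℚ × ℚ ≃+ Γ) (he : Monotone e) (φ : MvPowerSeries (Fin 2) F)
    {γ : Γ} (h : ¬ ∃ x, expo e x = γ) : (ofMv e he φ).coeff γ = 0 :=
  Function.extend_apply' _ _ _ h

variable [IsOrderedAddMonoid Γ]

theorem ofMv_mul (e : ℚ × ℚ ≃+ Γ) (he : Monotone e) (φ ψ : MvPowerSeries (Fin 2) F) :
    ofMv e he (φ * ψ) = ofMv e he φ * ofMv e he ψ := by
  classical
  ext γ
  rw [HahnSeries.coeff_mul]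
  by_cases h : ∃ x, expo e x = γ
  · obtain ⟨n, rfl⟩ := h
    rw [coeff_ofMv_expo, MvPowerSeries.coeff_mul]
    symm
    refine Finset.sum_bij_ne_zero
      (fun a _ h0 => ((Classical.choose (p := fun x => expo e x = a.1) ?_,
        Classical.choose (p := fun x => expo e x = a.2) ?_))) ?_ ?_ ?_ ?_
    · by_contra hn
      exact h0 (by rw [coeff_ofMv_of_not e he φ hn, zero_mul])
    · by_contra hn
      exact h0 (by rw [coeff_ofMv_of_not e he ψ hn, mul_zero])
    · intro a ha h0
      generalize_proofs h1 h2
      rw [Finset.HasAntidiagonal.mem_antidiagonal]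
      apply expo_injective e
      rw [expo_add, h1.choose_spec, h2.choose_spec]
      exact (Finset.mem_antidiagonal.1 ha).2.2
    · intro a ha h0 b hb h0' hab
      generalize_proofs h1 h2 h3 h4 at hab
      have hab1 := congrArg (fun z => expo e z.1) hab
      have hab2 := congrArg (fun z => expo e z.2) hab
      refine Prod.ext ?_ ?_
      · exact h1.choose_spec.symm.trans (hab1.trans h3.choose_spec)
      · exact h2.choose_spec.symm.trans (hab2.trans h4.choose_spec)
    · rintro ⟨x, y⟩ hxy h0
      rw [Finset.HasAntidiagonal.mem_antidiagonal] at hxy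
      refine ⟨(expo e x, expo e y), ?_, ?_, ?_⟩
      · rw [Finset.mem_antidiagonal]
        refine ⟨?_, ?_, by rw [← expo_add, hxy]⟩
        · rw [HahnSeries.mem_support, coeff_ofMv_expo]
          exact left_ne_zero_of_mul h0
        · rw [HahnSeries.mem_support, coeff_ofMv_expo]
          exact right_ne_zero_of_mul h0
      · simpa [coeff_ofMv_expo] using h0
      · generalize_proofs h1 h2
        exact Prod.ext (expo_injective e h1.choose_spec) (expo_injective e h2.choose_spec)
    · intro a ha h0
      generalize_proofs h1 h2
      dsimp only
      rw [← coeff_ofMv_expo e he φ, ← coeff_ofMv_expo e he ψ, h1.choose_spec, h2.choose_spec]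
  · rw [coeff_ofMv_of_not e he _ h, Finset.sum_eq_zero]
    rintro ⟨a, b⟩ hab
    rw [Finset.mem_antidiagonal] at hab
    by_contra h0
    have h1 : ∃ x, expo e x = a := by
      by_contra hn
      exact h0 (by rw [coeff_ofMv_of_not e he φ hn, zero_mul])
    have h2 : ∃ x, expo e x = b := by
      by_contra hn
      exact h0 (by rw [coeff_ofMv_of_not e he ψ hn, mul_zero])
    obtain ⟨x, rfl⟩ := h1
    obtain ⟨y, rfl⟩ := h2
    exact h ⟨x + y, by rw [expo_add]; exact hab.2.2⟩

/-- The embedding of the power series ring `F[[t₁, t₂]]` into `F((t₁^ℚ, t₂^ℚ))`. -/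
noncomputable def ofMvHom (F : Type*) [Field F] (e : ℚ × ℚ ≃+ Γ) (he : Monotone e) :
    MvPowerSeries (Fin 2) F →+* HahnSeries Γ F where
  toFun := ofMv e he
  map_mul' := ofMv_mul e he
  map_one' := by
    classical
    ext γ
    by_cases h : ∃ x, expo e x = γ
    · obtain ⟨x, rfl⟩ := h
      have h0 : expo e 0 = 0 := map_zero e
      have h1 : expo e x = 0 ↔ x = 0 := by rw [← h0, (expo_injective e).eq_iff]
      rw [coeff_ofMv_expo, MvPowerSeries.coeff_one, HahnSeries.coeff_one]
      simp only [h1]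
    · rw [coeff_ofMv_of_not e he _ h, HahnSeries.coeff_one, if_neg]
      rintro rfl
      exact h ⟨0, map_zero e⟩
  map_zero' := by
    ext γ
    by_cases h : ∃ x, expo e x = γ
    · obtain ⟨x, rfl⟩ := h
      rw [coeff_ofMv_expo]; simp
    · rw [coeff_ofMv_of_not e he _ h]; simp
  map_add' φ ψ := by
    ext γ
    by_cases h : ∃ x, expo e x = γ
    · obtain ⟨x, rfl⟩ := h
      simp [coeff_ofMv_expo]
    · simp [coeff_ofMv_of_not e he _ h]

theorem ofMvHom_injective (e : ℚ × ℚ ≃+ Γ) (he : Monotone e) :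
    Function.Injective (ofMvHom F e he) := by
  intro φ ψ h
  ext x
  rw [← coeff_ofMv_expo e he φ, ← coeff_ofMv_expo e he ψ]
  exact congrArg (fun g : HahnSeries Γ F => g.coeff (expo e x)) h

/-- The field `F((t₁, t₂))`: the field of fractions of `F[[t₁, t₂]]`, taken inside
`F((t₁^ℚ, t₂^ℚ))`. -/
noncomputable def fracField (F : Type*) [Field F] (e : ℚ × ℚ ≃+ Γ) (he : Monotone e) :
    Subfield (HahnSeries Γ F) :=
  Subfield.closure (Set.range (ofMvHom F e he))

/-- The sequence `a` has (not necessarily least) period `N` after `M` terms. -/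
def HasPeriodAfter {α : Type*} (a : ℕ → α) (N M : ℕ) : Prop :=
  ∀ n, M ≤ n → a (n + N) = a n

/-- The sequence `a` is eventually periodic. -/
def EventuallyPeriodic {α : Type*} (a : ℕ → α) : Prop :=
  ∃ N M : ℕ, 0 < N ∧ HasPeriodAfter a N M

/-- The exponent `(-s₁ / p ^ i, -s₂ / p ^ j)` of the monomial
`t₁ ^ (-s₁ / p ^ i) * t₂ ^ (-s₂ / p ^ j)`. -/
def negExp (p s₁ s₂ i j : ℕ) : ℚ × ℚ :=
  (-(s₁ : ℚ) / (p : ℚ) ^ i, -(s₂ : ℚ) / (p : ℚ) ^ j)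

end TwoVar

/-! Let `q = p ^ m` be the order of `F`. Raising a Hahn series to the power `q ^ k` fixes its
coefficients and multiplies its exponents by `q ^ k` (`coeff_pow_char_pow`), so on the exponents of
`f` it is a shift by `m * k` along the diagonals of the index grid.

If `f` is algebraic, its powers `f ^ q ^ k` satisfy a linear relation with power series coefficients
`A k` (`exists_additive_relation`). As `0 ≤ s / p ^ a < 1`, comparing coefficients at `(x 0 - s₁ / p
^ i, x 1 - s₂ / p ^ j)` isolates the coefficients of the `A k` at `x`. This is one linear recurrence
with constant coefficients, valid on every diagonal (`diagonal_relation`). Over a finite field such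
a recurrence has a period and preperiod independent of the diagonal. For a row, other exponents
isolate only the second coordinate, and the first `I` rows together form a finite-state recurrence
in the column index (`row_determined`). Columns follow by exchanging the variables.

Conversely, take `l` a multiple of both `m` and the diagonal period. Then `f ^ p ^ l - f` is
supported in finitely many rows and columns, each of which is algebraic. An algebraic `f ^ p ^ l -
f` makes `f` algebraic, as in Artin–Schreier theory (`isAlgebraic_of_pow_sub`). The rows of `f` are
treated by the same device, with finite support in place of finitely many lines
(`isAlgebraic_restrict_row`). -/

namespace TwoVar

/-! ### Restrictions of Hahn series and Frobenius -/

section Hahn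

open scoped Pointwise

variable {Γ : Type*} [LinearOrder Γ] {F : Type*} [Field F]

open Classical in
/-- The part of a Hahn series supported in a set of exponents. -/
noncomputable def restrict (S : Set Γ) (f : HahnSeries Γ F) : HahnSeries Γ F where
  coeff γ := if γ ∈ S then f.coeff γ else 0
  isPWO_support' := f.isPWO_support.mono fun γ hγ h => hγ (by simp [h])

open Classical in
theorem coeff_restrict (S : Set Γ) (f : HahnSeries Γ F) (γ : Γ) :
    (restrict S f).coeff γ = if γ ∈ S then f.coeff γ else 0 := rfl

theorem coeff_restrict_of_mem {S : Set Γ} (f : HahnSeries Γ F) {γ : Γ} (h : γ ∈ S) :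
    (restrict S f).coeff γ = f.coeff γ := if_pos h

theorem coeff_restrict_of_notMem {S : Set Γ} (f : HahnSeries Γ F) {γ : Γ} (h : γ ∉ S) :
    (restrict S f).coeff γ = 0 := if_neg h

theorem support_restrict_subset (S : Set Γ) (f : HahnSeries Γ F) :
    (restrict S f).support ⊆ f.support := by
  intro γ hγ h
  refine hγ ?_
  rw [coeff_restrict, h, ite_self]

theorem restrict_finset (T : Finset Γ) (f : HahnSeries Γ F) :
    restrict (T : Set Γ) f = ∑ γ ∈ T, HahnSeries.single γ (f.coeff γ) := by
  classical
  ext γ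
  rw [HahnSeries.coeff_sum]
  by_cases h : γ ∈ T
  · rw [coeff_restrict_of_mem f (Finset.mem_coe.2 h), Finset.sum_eq_single_of_mem γ h,
      HahnSeries.coeff_single_same]
    exact fun δ _ hδ => HahnSeries.coeff_single_of_ne hδ.symm
  · rw [coeff_restrict_of_notMem f (Finset.mem_coe.not.2 h), Finset.sum_eq_zero]
    exact fun δ hδ => HahnSeries.coeff_single_of_ne fun h' => h (h' ▸ hδ)

theorem restrict_union (S T : Set Γ) (f : HahnSeries Γ F) :
    restrict (S ∪ T) f = restrict S f + restrict T f - restrict (S ∩ T) f := by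
  ext γ
  by_cases h : γ ∈ S <;> by_cases h' : γ ∈ T <;> simp [coeff_restrict, h, h']

theorem restrict_eq_self {S : Set Γ} {f : HahnSeries Γ F} (h : f.support ⊆ S) :
    restrict S f = f := by
  ext γ
  by_cases hγ : γ ∈ S
  · exact coeff_restrict_of_mem f hγ
  · rw [coeff_restrict_of_notMem f hγ]
    by_contra h0
    exact hγ (h (Ne.symm h0))

variable [AddCommGroup Γ] [IsOrderedAddMonoid Γ]

theorem coeff_mul_of_support_subset {x y : HahnSeries Γ F} {s t : Set Γ} (hs : s.IsPWO)
    (ht : t.IsPWO) (hx : x.support ⊆ s) (hy : y.support ⊆ t) (γ : Γ) :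
    (x * y).coeff γ = ∑ ab ∈ Finset.antidiagonal hs ht γ, x.coeff ab.1 * y.coeff ab.2 := by
  rw [HahnSeries.coeff_mul]
  refine Finset.sum_subset ?_ ?_
  · intro ab h
    rw [Finset.mem_antidiagonal] at h ⊢
    exact ⟨hx h.1, hy h.2.1, h.2.2⟩
  · intro ab h h'
    rw [Finset.mem_antidiagonal] at h h'
    by_contra h0
    exact h' ⟨left_ne_zero_of_mul h0, right_ne_zero_of_mul h0, h.2.2⟩

/-- Each coefficient of a power of a Hahn series depends on finitely many coefficients only. -/
theorem exists_finset_coeff_restrict_pow (f : HahnSeries Γ F) (n : ℕ) :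
    ∃ W : Set Γ, W.IsPWO ∧ (∀ S, (restrict S f ^ n).support ⊆ W) ∧
      ∀ γ, ∃ T : Finset Γ, ∀ S : Set Γ, ↑T ⊆ S →
        (restrict S f ^ n).coeff γ = (f ^ n).coeff γ := by
  classical
  -- The set `W` does not depend on `S`, so for all restrictions the convolution runs over one
  -- finite antidiagonal.
  induction n with
  | zero =>
    refine ⟨(1 : HahnSeries Γ F).support, HahnSeries.isPWO_support _, fun S => by simp, fun γ =>
      ⟨∅, fun S _ => by simp⟩⟩
  | succ n ih =>
    obtain ⟨W, hW, hsub, hT⟩ := ih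
    choose T hT using hT
    have hsub1 : (f ^ n).support ⊆ W := by
      have := hsub Set.univ
      rwa [restrict_eq_self (Set.subset_univ _)] at this
    refine ⟨W + f.support, hW.add f.isPWO_support, fun S => ?_, fun γ => ?_⟩
    · rw [pow_succ]
      exact HahnSeries.support_mul_subset.trans
        (Set.add_subset_add (hsub S) (support_restrict_subset S f))
    · refine ⟨(Finset.antidiagonal hW f.isPWO_support γ).biUnion fun ab => insert ab.2 (T ab.1),
        fun S hS => ?_⟩
      rw [pow_succ, pow_succ,
        coeff_mul_of_support_subset hW f.isPWO_support (hsub S) (support_restrict_subset S f),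
        coeff_mul_of_support_subset hW f.isPWO_support hsub1 subset_rfl]
      refine Finset.sum_congr rfl fun ab hab => ?_
      have h1 : ∀ x ∈ insert ab.2 (T ab.1), x ∈ S := fun x hx =>
        hS (Finset.mem_coe.2 (Finset.mem_biUnion.2 ⟨ab, hab, hx⟩))
      rw [hT ab.1 S fun x hx => h1 x (Finset.mem_insert_of_mem hx),
        coeff_restrict_of_mem f (h1 _ (Finset.mem_insert_self _ _))]

/-- Frobenius acts on Hahn series in characteristic `p` term by term. -/
theorem coeff_pow_char_pow (p : ℕ) [Fact p.Prime] [CharP F p] (f : HahnSeries Γ F) (k : ℕ)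
    (γ : Γ) : (f ^ p ^ k).coeff (p ^ k • γ) = f.coeff γ ^ p ^ k := by
  classical
  have : CharP (HahnSeries Γ F) p :=
    charP_of_injective_ringHom (HahnSeries.C_injective (Γ := Γ) (R := F)) p
  obtain ⟨W, -, -, hT⟩ := exists_finset_coeff_restrict_pow f (p ^ k)
  obtain ⟨T, hT⟩ := hT (p ^ k • γ)
  have hp : p ^ k ≠ 0 := pow_ne_zero _ (Fact.out : p.Prime).ne_zero
  -- Additivity of Frobenius applies only to finite sums, hence the truncation; `γ` is inserted so
  -- that its own term is present.
  rw [← hT (insert γ T : Finset Γ) (by simp), restrict_finset, sum_pow_char_pow,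
    HahnSeries.coeff_sum, Finset.sum_eq_single γ]
  · rw [HahnSeries.single_pow, HahnSeries.coeff_single_same]
  · intro δ _ hδ
    rw [HahnSeries.single_pow, HahnSeries.coeff_single_of_ne]
    exact fun h => hδ (nsmul_right_injective hp h).symm
  · intro h
    exact absurd (Finset.mem_insert_self _ _) h

end Hahn

/-! ### Coefficients of Frobenius powers and of products with power series -/

section Coefficients

variable {Γ : Type*} [AddCommGroup Γ] [LinearOrder Γ] [IsOrderedAddMonoid Γ]
  {F : Type*} [Field F]

theorem coeff_pow_char_pow_apply (e : ℚ × ℚ ≃+ Γ) (p : ℕ) [Fact p.Prime] [CharP F p]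
    (f : HahnSeries Γ F) (k : ℕ) (a b : ℚ) :
    (f ^ p ^ k).coeff (e (a, b)) = f.coeff (e (a / p ^ k, b / p ^ k)) ^ p ^ k := by
  have hp : (p : ℚ) ^ k ≠ 0 := pow_ne_zero _ (Nat.cast_ne_zero.2 (Fact.out : p.Prime).ne_zero)
  rw [← coeff_pow_char_pow p f k, ← map_nsmul]
  congr 2
  ext <;> simp [mul_div_cancel₀ _ hp]

/-- Two partially well-ordered supports contain only finitely many pairs with a given sum. This is
needed to subtract two `finsum`s term by term. -/
theorem hasFiniteSupport_coeff_mul (e : ℚ × ℚ ≃+ Γ) (he : Monotone e)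
    (φ : MvPowerSeries (Fin 2) F) (g : HahnSeries Γ F) (γ : Γ) :
    Function.HasFiniteSupport fun x : Fin 2 →₀ ℕ =>
      MvPowerSeries.coeff x φ * g.coeff (γ - expo e x) := by
  have hinj : Function.Injective fun x : Fin 2 →₀ ℕ => (expo e x, γ - expo e x) :=
    fun x y h => expo_injective e (Prod.ext_iff.1 h).1
  refine ((Finset.antidiagonal (ofMv e he φ).isPWO_support g.isPWO_support γ).finite_toSet.preimage
    hinj.injOn).subset ?_
  intro x hx
  rw [Function.mem_support] at hx
  rw [Set.mem_preimage, Finset.mem_coe, Finset.mem_antidiagonal]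
  refine ⟨?_, right_ne_zero_of_mul hx, add_sub_cancel _ _⟩
  rw [HahnSeries.mem_support, coeff_ofMv_expo]
  exact left_ne_zero_of_mul hx

theorem coeff_ofMv_mul (e : ℚ × ℚ ≃+ Γ) (he : Monotone e) (φ : MvPowerSeries (Fin 2) F)
    (g : HahnSeries Γ F) (γ : Γ) :
    (ofMv e he φ * g).coeff γ =
      ∑ᶠ x : Fin 2 →₀ ℕ, MvPowerSeries.coeff x φ * g.coeff (γ - expo e x) := by
  classical
  have hinj : Function.Injective fun x : Fin 2 →₀ ℕ => (expo e x, γ - expo e x) :=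
    fun x y h => expo_injective e (Prod.ext_iff.1 h).1
  rw [HahnSeries.coeff_mul, ← Finset.sum_preimage _ _ hinj.injOn,
    finsum_eq_sum_of_support_subset]
  · refine Finset.sum_congr rfl fun x _ => ?_
    rw [coeff_ofMv_expo]
  · intro x hx
    rw [Function.mem_support] at hx
    rw [Finset.mem_coe, Finset.mem_preimage, Finset.mem_antidiagonal]
    refine ⟨?_, right_ne_zero_of_mul hx, add_sub_cancel _ _⟩
    rw [HahnSeries.mem_support, coeff_ofMv_expo]
    exact left_ne_zero_of_mul hx
  · rintro ⟨a, b⟩ hab hr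
    rw [Finset.mem_antidiagonal] at hab
    rw [coeff_ofMv_of_not, zero_mul]
    rintro ⟨x, rfl⟩
    exact hr ⟨x, Prod.ext rfl (by rw [← hab.2.2]; exact add_sub_cancel_left _ _)⟩

end Coefficients

/-! ### Finite-state sequences -/

section Sequences

theorem HasPeriodAfter.mul {α : Type*} {a : ℕ → α} {N M : ℕ} (h : HasPeriodAfter a N M) (k : ℕ) :
    HasPeriodAfter a (N * k) M := by
  induction k with
  | zero => intro n _; simp
  | succ k ih =>
    intro n hn
    rw [Nat.mul_succ, ← add_assoc, h _ (by omega), ih n hn]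

/-- A sequence in a finite type whose terms are determined by the `R` preceding ones is eventually
periodic, with a period and a preperiod that depend on `R` and the type only. -/
theorem exists_hasPeriodAfter_of_determined (X : Type*) [Finite X] (R : ℕ) :
    ∃ M N : ℕ, 0 < N ∧ ∀ w : ℕ → X,
      (∀ n n', (∀ k < R, w (n + k) = w (n' + k)) → w (n + R) = w (n' + R)) →
      HasPeriodAfter w N M := by
  classical
  have := Fintype.ofFinite X
  set M := Fintype.card (Fin R → X) with hM
  -- There are `M` possible windows of length `R`, so two of the first `M + 1` agree. Their distance
  -- is a period that depends on `w` but is at most `M`, so it divides `M!`.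
  refine ⟨M, M.factorial, Nat.factorial_pos _, fun w hw => ?_⟩
  obtain ⟨i, j, hij, heq⟩ := Fintype.exists_ne_map_eq_of_card_lt
    (fun (i : Fin (M + 1)) (k : Fin R) => w (i + k)) (by simp [hM])
  wlog h : i < j generalizing i j
  · exact this j i hij.symm heq.symm (lt_of_le_of_ne (not_lt.1 h) hij.symm)
  have hwin : ∀ n, ∀ k < R, w (i + n + k) = w (j + n + k) := by
    intro n
    induction n with
    | zero => intro k hk; exact congrFun heq ⟨k, hk⟩
    | succ n ih =>
      intro k hk
      rcases Nat.lt_or_ge (k + 1) R with h1 | h1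
      · have := ih (k + 1) h1
        rwa [show (i : ℕ) + n + (k + 1) = i + (n + 1) + k by ring,
          show (j : ℕ) + n + (k + 1) = j + (n + 1) + k by ring] at this
      · have := hw _ _ ih
        rwa [show R = k + 1 by omega, show (i : ℕ) + n + (k + 1) = i + (n + 1) + k by ring,
          show (j : ℕ) + n + (k + 1) = j + (n + 1) + k by ring] at this
  have hterm : ∀ n, w (i + n) = w (j + n) := by
    intro n
    rcases Nat.eq_zero_or_pos R with rfl | hR
    · exact hw _ _ fun k hk => absurd hk (Nat.not_lt_zero _)
    · exact hwin n 0 hR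
  have hper : HasPeriodAfter w (j - i) M := by
    intro n hn
    have hi := i.2
    have h' : (i : ℕ) < j := h
    have := hterm (n - i)
    rw [show (i : ℕ) + (n - i) = n by omega, show (j : ℕ) + (n - i) = n + (j - i) by omega] at this
    exact this.symm
  have hd : (j - i : ℕ) ∣ M.factorial := by
    have hj := j.2
    have h' : (i : ℕ) < j := h
    exact Nat.dvd_factorial (by omega) (by omega)
  obtain ⟨k, hk⟩ := hd
  rw [hk]
  exact hper.mul k

end Sequences

/-! ### Additive relations for algebraic series -/

section Relation

variable {Γ : Type*} [AddCommGroup Γ] [LinearOrder Γ] [IsOrderedAddMonoid Γ]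
  {F : Type*} [Field F]

theorem exists_eq_div_of_mem_fracField {e : ℚ × ℚ ≃+ Γ} {he : Monotone e} {x : HahnSeries Γ F}
    (hx : x ∈ fracField F e he) :
    ∃ φ ψ : MvPowerSeries (Fin 2) F, ψ ≠ 0 ∧ ofMvHom F e he ψ * x = ofMvHom F e he φ := by
  obtain ⟨y, hy, z, hz, rfl⟩ := Subfield.mem_closure_iff.1 hx
  rw [← RingHom.coe_range, Subring.closure_eq] at hy hz
  obtain ⟨φ, rfl⟩ := hy
  obtain ⟨ψ, rfl⟩ := hz
  -- A zero denominator makes the quotient `0` by convention, which is written `0 / 1` instead.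
  by_cases h : ψ = 0
  · exact ⟨0, 1, one_ne_zero, by simp [h]⟩
  · refine ⟨φ, ψ, h, mul_div_cancel₀ _ ?_⟩
    rwa [Ne, map_eq_zero_iff _ (ofMvHom_injective e he)]

theorem exists_common_denominator (e : ℚ × ℚ ≃+ Γ) (he : Monotone e) {ι : Type*} (s : Finset ι)
    (c : ι → fracField F e he) :
    ∃ ψ : MvPowerSeries (Fin 2) F, ψ ≠ 0 ∧
      ∀ i ∈ s, ∃ φ, ofMvHom F e he φ = ofMvHom F e he ψ * (c i : HahnSeries Γ F) := by
  classical
  induction s using Finset.induction_on with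
  | empty => exact ⟨1, one_ne_zero, by simp⟩
  | insert i s _ ih =>
    obtain ⟨ψ, hψ, h⟩ := ih
    obtain ⟨φ', ψ', hψ', h'⟩ := exists_eq_div_of_mem_fracField (c i).2
    refine ⟨ψ * ψ', mul_ne_zero hψ hψ', fun j hj => ?_⟩
    rcases Finset.mem_insert.1 hj with rfl | hj
    · exact ⟨ψ * φ', by rw [map_mul, map_mul, ← h', mul_assoc]⟩
    · obtain ⟨φ, hφ⟩ := h j hj
      exact ⟨φ * ψ', by rw [map_mul, map_mul, hφ]; ring⟩

/-- The iterated `q`-th powers of an algebraic element satisfy a linear relation with power series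
coefficients. -/
theorem exists_additive_relation {e : ℚ × ℚ ≃+ Γ} {he : Monotone e} {f : HahnSeries Γ F}
    (hf : IsAlgebraic (fracField F e he) f) (q : ℕ) :
    ∃ (r : ℕ) (A : ℕ → MvPowerSeries (Fin 2) F), A r ≠ 0 ∧
      ∑ k ∈ Finset.range (r + 1), ofMv e he (A k) * f ^ q ^ k = 0 := by
  classical
  set K := fracField F e he
  have : Module.Finite K (Algebra.adjoin K {f}) :=
    Module.Finite.iff_fg.2 hf.isIntegral.fg_adjoin_singleton
  have hmem : ∀ k, f ^ q ^ k ∈ Algebra.adjoin K {f} := fun k =>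
    pow_mem (Algebra.self_mem_adjoin_singleton K f) _
  set d := Module.finrank K (Algebra.adjoin K {f})
  have hdep : ¬ LinearIndependent K
      fun k : Fin (d + 1) => (⟨f ^ q ^ (k : ℕ), hmem k⟩ : Algebra.adjoin K {f}) := by
    intro h
    have := h.fintype_card_le_finrank
    rw [Fintype.card_fin] at this
    omega
  obtain ⟨c, hc, i₀, hi₀⟩ := Fintype.not_linearIndependent_iff.1 hdep
  obtain ⟨ψ, hψ, hφ⟩ := exists_common_denominator e he Finset.univ c
  choose φ hφ using fun i => hφ i (Finset.mem_univ i)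
  have hψ' : ofMvHom F e he ψ ≠ 0 := by rwa [Ne, map_eq_zero_iff _ (ofMvHom_injective e he)]
  have hsum : ∑ k : Fin (d + 1), ofMvHom F e he (φ k) * f ^ q ^ (k : ℕ) = 0 := by
    have h1 := congrArg (fun z : Algebra.adjoin K {f} => ofMvHom F e he ψ * (z : HahnSeries Γ F)) hc
    simp only [AddSubmonoidClass.coe_finsetSum, ZeroMemClass.coe_zero, mul_zero,
      Finset.mul_sum] at h1
    rw [← h1]
    refine Finset.sum_congr rfl fun k _ => ?_
    rw [hφ, mul_assoc]
    rfl
  set B : ℕ → MvPowerSeries (Fin 2) F := fun k => if h : k < d + 1 then φ ⟨k, h⟩ else 0 with hB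
  have hB0 : B i₀ ≠ 0 := by
    simp only [hB, i₀.2, dif_pos, Fin.eta]
    intro h0
    have := hφ i₀
    rw [h0, map_zero] at this
    exact hi₀ (Subtype.ext ((mul_eq_zero.1 this.symm).resolve_left hψ'))
  have hsumB : ∑ k ∈ Finset.range (d + 1), ofMv e he (B k) * f ^ q ^ k = 0 := by
    rw [← hsum, Finset.sum_range]
    refine Finset.sum_congr rfl fun k _ => ?_
    simp only [hB, k.2, dif_pos, Fin.eta]
    rfl
  -- Cutting the relation at its last nonzero coefficient gives the nonzero leading term.
  set r := Nat.findGreatest (fun k => B k ≠ 0) d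
  have hrd : r ≤ d := Nat.findGreatest_le d
  refine ⟨r, B, Nat.findGreatest_spec (P := fun k => B k ≠ 0) (Nat.lt_succ_iff.1 i₀.2) hB0, ?_⟩
  rw [← hsumB]
  refine Finset.sum_subset (Finset.range_subset_range.2 (by omega)) fun k hk hk' => ?_
  rw [Finset.mem_range] at hk hk'
  have : B k = 0 := by
    by_contra h0
    exact Nat.findGreatest_is_greatest (P := fun k => B k ≠ 0) (n := d) (k := k)
      (by omega) (by omega) h0
  rw [this, show ofMv e he (0 : MvPowerSeries (Fin 2) F) = 0 from map_zero (ofMvHom F e he),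
    zero_mul]

theorem hasFiniteSupport_coeff_mul_pow (e : ℚ × ℚ ≃+ Γ) (he : Monotone e) (p : ℕ) [Fact p.Prime]
    [CharP F p] (φ : MvPowerSeries (Fin 2) F) (f : HahnSeries Γ F) {l : ℕ}
    (hl : ∀ c : F, c ^ p ^ l = c) (a b : ℚ) :
    Function.HasFiniteSupport fun x : Fin 2 →₀ ℕ => MvPowerSeries.coeff x φ *
      f.coeff (e ((a - x 0) / p ^ l, (b - x 1) / p ^ l)) := by
  have h := hasFiniteSupport_coeff_mul e he φ (f ^ p ^ l) (e (a, b))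
  simp only [expo, ← map_sub, Prod.mk_sub_mk, coeff_pow_char_pow_apply, hl] at h
  exact h

theorem coeff_ofMv_mul_pow (e : ℚ × ℚ ≃+ Γ) (he : Monotone e) (p : ℕ) [Fact p.Prime]
    [CharP F p] (φ : MvPowerSeries (Fin 2) F) (f : HahnSeries Γ F) {l : ℕ}
    (hl : ∀ c : F, c ^ p ^ l = c) (a b : ℚ) :
    (ofMv e he φ * f ^ p ^ l).coeff (e (a, b)) = ∑ᶠ x : Fin 2 →₀ ℕ, MvPowerSeries.coeff x φ *
      f.coeff (e ((a - x 0) / p ^ l, (b - x 1) / p ^ l)) := by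
  rw [coeff_ofMv_mul]
  congr 1
  ext x
  rw [expo, ← map_sub, Prod.mk_sub_mk, coeff_pow_char_pow_apply, hl]

end Relation

/-! ### Integrality of differences of exponents -/

section Arithmetic

theorem div_pow_lt_one {s p a : ℕ} (hs : s < p) (ha : 0 < a) : (s : ℚ) / p ^ a < 1 := by
  have hp : 0 < p := by omega
  rw [div_lt_one (by positivity)]
  exact_mod_cast hs.trans_le (Nat.le_self_pow ha.ne' p)

theorem mul_pow_div_pow_of_le {s p l j : ℕ} (hp : 0 < p) (h : l ≤ j) :
    (s : ℚ) * p ^ l / p ^ j = s / p ^ (j - l) := by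
  have : (p : ℚ) ≠ 0 := by positivity
  obtain ⟨d, rfl⟩ := Nat.exists_eq_add_of_le h
  rw [Nat.add_sub_cancel_left, pow_add]
  field_simp

/-- If `l < j`, both terms lie in `[0, 1)`. Otherwise the first is an integer, so `s / p ^ a` is an
integer in `[0, 1)`, which forces `s = 0`. -/
theorem int_eq_zero_of_mul_pow_div_sub {s p l j a : ℕ} (hs : s < p) (ha : 0 < a) {z : ℤ}
    (h : (s : ℚ) * p ^ l / p ^ j - s / p ^ a = z) : z = 0 := by
  have hp : 0 < p := by omega
  have h0 : (0 : ℚ) ≤ s / p ^ a := by positivity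
  have h1 := div_pow_lt_one hs ha
  rcases Nat.lt_or_ge l j with hlj | hlj
  · rw [mul_pow_div_pow_of_le hp hlj.le] at h
    have h0' : (0 : ℚ) ≤ s / p ^ (j - l) := by positivity
    have h1' := div_pow_lt_one hs (a := j - l) (by omega)
    have hz1 : (z : ℚ) < 1 := by linarith
    have hz2 : (-1 : ℚ) < z := by linarith
    have hz1' : z < 1 := by exact_mod_cast hz1
    have hz2' : -1 < z := by exact_mod_cast hz2
    omega
  · obtain ⟨d, rfl⟩ := Nat.exists_eq_add_of_le hlj
    have hpj : (p : ℚ) ^ j ≠ 0 := by positivity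
    have h2 : (s : ℚ) * p ^ (j + d) / p ^ j = s * p ^ d := by
      rw [pow_add]; field_simp
    rw [h2] at h
    have hw : (s : ℚ) / p ^ a = ((s * p ^ d - z : ℤ) : ℚ) := by push_cast; linarith
    rw [hw] at h0 h1
    have h0' : 0 ≤ (s * p ^ d - z : ℤ) := by exact_mod_cast h0
    have h1' : (s * p ^ d - z : ℤ) < 1 := by exact_mod_cast h1
    have hz : (s * p ^ d - z : ℤ) = 0 := by omega
    rw [hz, Int.cast_zero, div_eq_zero_iff] at hw
    have hs0 : s = 0 := by
      rcases hw with hw | hw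
      · exact_mod_cast hw
      · exact absurd hw (by positivity)
    simpa [hs0] using hz

/-- This is the isolation principle: at exponents `n - s / p ^ a`, only the power series monomials
of degree `n` in that variable can contribute. -/
theorem eq_of_sub_div_pow_eq {s p l j a n x : ℕ} (hs : s < p) (ha : 0 < a)
    (h : ((n : ℚ) - s / p ^ a - x) / p ^ l = -(s : ℚ) / p ^ j) : x = n := by
  have hp : (0 : ℚ) < p := by exact_mod_cast (show 0 < p by omega)
  have h1 : (s : ℚ) * p ^ l / p ^ j - s / p ^ a = ((x - n : ℤ) : ℚ) := by
    rw [div_eq_iff (by positivity)] at h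
    push_cast
    have : (s : ℚ) * p ^ l / p ^ j = -(-(s : ℚ) / p ^ j * p ^ l) := by ring
    rw [this, ← h]; ring
  have := int_eq_zero_of_mul_pow_div_sub hs ha h1
  omega

theorem neg_div_pow_div_pow (s p a l : ℕ) :
    -((s : ℚ) / p ^ a) / p ^ l = -(s : ℚ) / p ^ (l + a) := by
  rw [pow_add, ← neg_div, div_div, mul_comm]

end Arithmetic

/-! ### Algebraic series have periodic coefficients -/

section Forward

variable {Γ : Type*} [AddCommGroup Γ] [LinearOrder Γ] {F : Type*} [Field F]

theorem exists_negExp_of_coeff_ne_zero {e : ℚ × ℚ ≃+ Γ} {p s₁ s₂ : ℕ} {f : HahnSeries Γ F}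
    (hf : ∀ γ ∈ f.support, ∃ i j : ℕ, 0 < i ∧ 0 < j ∧ γ = e (negExp p s₁ s₂ i j))
    {a b : ℚ} (h : f.coeff (e (a, b)) ≠ 0) :
    ∃ i j : ℕ, 0 < i ∧ 0 < j ∧ a = -(s₁ : ℚ) / p ^ i ∧ b = -(s₂ : ℚ) / p ^ j := by
  obtain ⟨i, j, hi, hj, hij⟩ := hf _ h
  have := e.injective hij
  exact ⟨i, j, hi, hj, (Prod.ext_iff.1 this).1, (Prod.ext_iff.1 this).2⟩

variable [IsOrderedAddMonoid Γ]

/-- An algebraic series satisfies a relation between its iterated `p ^ m`-th powers; here it is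
written coefficient by coefficient. -/
theorem exists_coeff_relation {e : ℚ × ℚ ≃+ Γ} {he : Monotone e} (p : ℕ) [Fact p.Prime]
    [CharP F p] {m : ℕ} (hm : ∀ c : F, c ^ p ^ m = c) {f : HahnSeries Γ F}
    (hf : IsAlgebraic (fracField F e he) f) :
    ∃ (r : ℕ) (A : ℕ → MvPowerSeries (Fin 2) F), A r ≠ 0 ∧
      (∀ k a b, Function.HasFiniteSupport fun x : Fin 2 →₀ ℕ => MvPowerSeries.coeff x (A k) *
        f.coeff (e ((a - x 0) / p ^ (m * k), (b - x 1) / p ^ (m * k)))) ∧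
      ∀ a b, ∑ k ∈ Finset.range (r + 1), ∑ᶠ x : Fin 2 →₀ ℕ, MvPowerSeries.coeff x (A k) *
        f.coeff (e ((a - x 0) / p ^ (m * k), (b - x 1) / p ^ (m * k))) = 0 := by
  have hl : ∀ (k : ℕ) (c : F), c ^ p ^ (m * k) = c := by
    intro k c
    induction k with
    | zero => simp
    | succ k ih => rw [Nat.mul_succ, pow_add, pow_mul, ih, hm]
  obtain ⟨r, A, hA, h⟩ := exists_additive_relation hf (p ^ m)
  refine ⟨r, A, hA, fun k a b => hasFiniteSupport_coeff_mul_pow e he p (A k) f (hl k) a b,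
    fun a b => ?_⟩
  have h1 := congrArg (fun g : HahnSeries Γ F => g.coeff (e (a, b))) h
  rw [HahnSeries.coeff_zero, HahnSeries.coeff_sum] at h1
  rw [← h1]
  refine Finset.sum_congr rfl fun k _ => ?_
  rw [← pow_mul, coeff_ofMv_mul_pow e he p (A k) f (hl k)]

variable {e : ℚ × ℚ ≃+ Γ} {p s₁ s₂ m r : ℕ} {A : ℕ → MvPowerSeries (Fin 2) F}
  {f : HahnSeries Γ F}

-- Isolation in both coordinates leaves the single monomial `x` in each sum. The coefficients of the
-- resulting recurrence do not depend on `i` and `j`.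
omit [IsOrderedAddMonoid Γ] in
theorem diagonal_relation (hs₁ : s₁ < p) (hs₂ : s₂ < p)
    (hf : ∀ γ ∈ f.support, ∃ i j : ℕ, 0 < i ∧ 0 < j ∧ γ = e (negExp p s₁ s₂ i j))
    (hrel : ∀ a b, ∑ k ∈ Finset.range (r + 1), ∑ᶠ x : Fin 2 →₀ ℕ, MvPowerSeries.coeff x (A k) *
        f.coeff (e ((a - x 0) / p ^ (m * k), (b - x 1) / p ^ (m * k))) = 0)
    (x : Fin 2 →₀ ℕ) {i j : ℕ} (hi : 0 < i) (hj : 0 < j) :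
    ∑ k ∈ Finset.range (r + 1), MvPowerSeries.coeff x (A k) *
      f.coeff (e (negExp p s₁ s₂ (m * k + i) (m * k + j))) = 0 := by
  rw [← hrel (x 0 - s₁ / p ^ i) (x 1 - s₂ / p ^ j)]
  refine Finset.sum_congr rfl fun k _ => ?_
  rw [finsum_eq_single _ x]
  · rw [sub_sub_cancel_left, sub_sub_cancel_left, neg_div_pow_div_pow, neg_div_pow_div_pow]
    rfl
  · intro y hy
    by_contra h0
    obtain ⟨i', j', -, -, h1, h2⟩ :=
      exists_negExp_of_coeff_ne_zero hf (right_ne_zero_of_mul h0)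
    refine hy (Finsupp.ext fun t => ?_)
    fin_cases t
    · exact eq_of_sub_div_pow_eq hs₁ hi h1
    · exact eq_of_sub_div_pow_eq hs₂ hj h2

omit [IsOrderedAddMonoid Γ] in
/-- The coefficients on the diagonals are determined by finitely many preceding ones. -/
theorem diagonal_determined (hm : 0 < m) (hs₁ : s₁ < p) (hs₂ : s₂ < p)
    (hf : ∀ γ ∈ f.support, ∃ i j : ℕ, 0 < i ∧ 0 < j ∧ γ = e (negExp p s₁ s₂ i j)) (hA : A r ≠ 0)
    (hrel : ∀ a b, ∑ k ∈ Finset.range (r + 1), ∑ᶠ x : Fin 2 →₀ ℕ, MvPowerSeries.coeff x (A k) *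
        f.coeff (e ((a - x 0) / p ^ (m * k), (b - x 1) / p ^ (m * k))) = 0)
    {i j i' j' : ℕ} (hi : 0 < i) (hj : 0 < j) (hi' : 0 < i') (hj' : 0 < j')
    (h : ∀ k < m * r, f.coeff (e (negExp p s₁ s₂ (i + k) (j + k))) =
      f.coeff (e (negExp p s₁ s₂ (i' + k) (j' + k)))) :
    f.coeff (e (negExp p s₁ s₂ (i + m * r) (j + m * r))) =
      f.coeff (e (negExp p s₁ s₂ (i' + m * r) (j' + m * r))) := by
  obtain ⟨x, hx⟩ : ∃ x, MvPowerSeries.coeff x (A r) ≠ 0 := by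
    by_contra! h0
    exact hA (MvPowerSeries.ext fun x => by simpa using h0 x)
  have h1 := diagonal_relation hs₁ hs₂ hf hrel x hi hj
  have h2 := diagonal_relation hs₁ hs₂ hf hrel x hi' hj'
  rw [Finset.sum_range_succ] at h1 h2
  have h3 : ∑ k ∈ Finset.range r, MvPowerSeries.coeff x (A k) *
      f.coeff (e (negExp p s₁ s₂ (m * k + i) (m * k + j))) =
      ∑ k ∈ Finset.range r, MvPowerSeries.coeff x (A k) *
      f.coeff (e (negExp p s₁ s₂ (m * k + i') (m * k + j'))) := by
    refine Finset.sum_congr rfl fun k hk => ?_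
    have := h (m * k) (Nat.mul_lt_mul_of_pos_left (Finset.mem_range.1 hk) hm)
    rw [add_comm (m * k), add_comm (m * k), add_comm (m * k), add_comm (m * k), this]
  rw [h3, ← h2] at h1
  have := mul_left_cancel₀ hx (add_left_cancel h1)
  rwa [add_comm i, add_comm j, add_comm i', add_comm j']

omit [IsOrderedAddMonoid Γ] in
/-- The coefficients in finitely many rows are determined by finitely many preceding ones in these
rows. -/
theorem row_determined (hm : 0 < m) (hs₁ : s₁ < p) (hs₂ : s₂ < p)
    (hf : ∀ γ ∈ f.support, ∃ i j : ℕ, 0 < i ∧ 0 < j ∧ γ = e (negExp p s₁ s₂ i j)) (hA : A r ≠ 0)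
    (hfin : ∀ k a b, Function.HasFiniteSupport fun x : Fin 2 →₀ ℕ => MvPowerSeries.coeff x (A k) *
        f.coeff (e ((a - x 0) / p ^ (m * k), (b - x 1) / p ^ (m * k))))
    (hrel : ∀ a b, ∑ k ∈ Finset.range (r + 1), ∑ᶠ x : Fin 2 →₀ ℕ, MvPowerSeries.coeff x (A k) *
        f.coeff (e ((a - x 0) / p ^ (m * k), (b - x 1) / p ^ (m * k))) = 0)
    {I j j' : ℕ} (hI : m * r ≤ I) (hj : 0 < j) (hj' : 0 < j')
    (h : ∀ k < m * r, ∀ i, 0 < i → i ≤ I → f.coeff (e (negExp p s₁ s₂ i (j + k))) =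
      f.coeff (e (negExp p s₁ s₂ i (j' + k)))) (i : ℕ) (hi : 0 < i) (hiI : i ≤ I) :
    f.coeff (e (negExp p s₁ s₂ i (j + m * r))) = f.coeff (e (negExp p s₁ s₂ i (j' + m * r))) := by
  induction i using Nat.strong_induction_on with
  | _ i ih =>
  have hp : (0 : ℚ) < p := by exact_mod_cast (show 0 < p by omega)
  have hp1 : (1 : ℚ) ≤ p := by exact_mod_cast (show 1 ≤ p by omega)
  -- Minimality of `x 0` ensures that the other surviving terms with `k = r` involve strictly
  -- smaller rows.
  obtain ⟨x, hx, hmin⟩ : ∃ x, MvPowerSeries.coeff x (A r) ≠ 0 ∧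
      ∀ y, MvPowerSeries.coeff y (A r) ≠ 0 → x 0 ≤ y 0 := by
    have hne : {x | MvPowerSeries.coeff x (A r) ≠ 0}.Nonempty := by
      by_contra h0
      rw [Set.not_nonempty_iff_eq_empty, Set.eq_empty_iff_forall_notMem] at h0
      exact hA (MvPowerSeries.ext fun x => by simpa using h0 x)
    obtain ⟨x, hx, hx'⟩ := exists_minimalFor_of_wellFoundedLT _ (fun x : Fin 2 →₀ ℕ => x 0) hne
    exact ⟨x, hx, fun y hy => (le_total (x 0) (y 0)).elim id fun h => hx' hy h⟩
  -- The factor `p ^ (m * r)` makes the term `k = r`, `y = x` fall in row `i` itself rather than `i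
  -- + m * r`; the price is that the first coordinate is no longer isolated.
  set a : ℚ := x 0 - s₁ * p ^ (m * r) / p ^ i with ha
  have hsecond : ∀ {k : ℕ} {c : ℚ} {y : Fin 2 →₀ ℕ} {b : ℕ}, 0 < b → y 1 ≠ x 1 →
      f.coeff (e (c, ((x 1 : ℚ) - s₂ / p ^ b - y 1) / p ^ (m * k))) = 0 := by
    intro k c y b hb hy
    by_contra h0
    obtain ⟨i', j', -, -, -, h2⟩ := exists_negExp_of_coeff_ne_zero hf h0
    exact hy (eq_of_sub_div_pow_eq hs₂ hb h2)
  -- a term other than the leading one takes the same value for both columns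
  have hterm : ∀ k ≤ r, ∀ y : Fin 2 →₀ ℕ, (k < r ∨ y ≠ x) →
      MvPowerSeries.coeff y (A k) * f.coeff (e ((a - y 0) / p ^ (m * k),
        ((x 1 : ℚ) - s₂ / p ^ j - y 1) / p ^ (m * k))) =
      MvPowerSeries.coeff y (A k) * f.coeff (e ((a - y 0) / p ^ (m * k),
        ((x 1 : ℚ) - s₂ / p ^ j' - y 1) / p ^ (m * k))) := by
    intro k hk y hky
    by_cases hy1 : y 1 = x 1
    swap
    · rw [hsecond hj hy1, hsecond hj' hy1]
    by_cases hyA : MvPowerSeries.coeff y (A k) = 0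
    · rw [hyA, zero_mul, zero_mul]
    congr 1
    rw [hy1, sub_sub_cancel_left, sub_sub_cancel_left, neg_div_pow_div_pow, neg_div_pow_div_pow]
    by_cases hi' : ∃ i', 0 < i' ∧ (a - y 0) / p ^ (m * k) = -(s₁ : ℚ) / p ^ i'
    swap
    · have h0 : ∀ b : ℚ, f.coeff (e ((a - y 0) / p ^ (m * k), b)) = 0 := by
        intro b
        by_contra h0
        obtain ⟨i', j', hi1, -, h1, -⟩ := exists_negExp_of_coeff_ne_zero hf h0
        exact hi' ⟨i', hi1, h1⟩
      rw [h0, h0]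
    obtain ⟨i', hi'0, hi'⟩ := hi'
    have hval : (s₁ : ℚ) * p ^ (m * r) / p ^ i - s₁ * p ^ (m * k) / p ^ i' = x 0 - y 0 := by
      rw [div_eq_iff (by positivity)] at hi'
      have : (s₁ : ℚ) * p ^ (m * k) / p ^ i' = -(-(s₁ : ℚ) / p ^ i' * p ^ (m * k)) := by ring
      rw [this, ← hi', ha]
      ring
    rw [hi']
    change f.coeff (e (negExp p s₁ s₂ i' _)) = f.coeff (e (negExp p s₁ s₂ i' _))
    rw [add_comm (m * k), add_comm (m * k)]
    rcases hk.lt_or_eq with hkr | rfl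
    · have hkr' : m * k < m * r := Nat.mul_lt_mul_of_pos_left hkr hm
      rcases Nat.lt_or_ge I i' with hIi' | hIi'
      · rw [mul_pow_div_pow_of_le (l := m * k) (by omega) (by omega)] at hval
        have hz := int_eq_zero_of_mul_pow_div_sub (a := i' - m * k) (z := (x 0 : ℤ) - y 0) hs₁
          (by omega) (by rw [hval]; push_cast; ring)
        have hz' : (x 0 : ℚ) - y 0 = 0 := by exact_mod_cast hz
        rw [hz', sub_eq_zero] at hval
        have hs0 : s₁ = 0 := by
          by_contra hs0
          have hs0' : (0 : ℚ) < s₁ := by exact_mod_cast Nat.pos_of_ne_zero hs0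
          rw [div_eq_div_iff (by positivity) (by positivity), mul_assoc, ← pow_add] at hval
          have h1 := mul_left_cancel₀ hs0'.ne' hval
          have h2 := Nat.pow_right_injective (show 2 ≤ p by omega)
            (show p ^ (m * r + (i' - m * k)) = p ^ i by exact_mod_cast h1)
          omega
        have h1 := h (m * k) hkr' 1 one_pos (by omega)
        simpa [negExp, hs0] using h1
      · exact h (m * k) hkr' i' hi'0 hIi'
    · have hyx : y ≠ x := hky.resolve_left (lt_irrefl _)
      have hlt : x 0 < y 0 := by
        refine lt_of_le_of_ne (hmin y hyA) fun h0 => hyx (Finsupp.ext fun t => ?_)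
        fin_cases t
        · exact h0.symm
        · exact hy1
      have hlt' : (x 0 : ℚ) < y 0 := by exact_mod_cast hlt
      have hii' : i' < i := by
        by_contra hle
        have : (s₁ : ℚ) * p ^ (m * k) / p ^ i' ≤ s₁ * p ^ (m * k) / p ^ i :=
          div_le_div_of_nonneg_left (by positivity) (by positivity)
            (pow_le_pow_right₀ hp1 (not_lt.1 hle))
        linarith
      exact ih i' hii' hi'0 (by omega)
  have h1 := hrel a (x 1 - s₂ / p ^ j)
  rw [← hrel a (x 1 - s₂ / p ^ j'), Finset.sum_range_succ, Finset.sum_range_succ] at h1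
  rw [Finset.sum_congr rfl fun k hk => finsum_congr
    fun y => hterm k (Finset.mem_range.1 hk).le y (Or.inl (Finset.mem_range.1 hk))] at h1
  have h2 := sub_eq_zero.2 (add_left_cancel h1)
  -- In the difference of the relations for `j` and `j'` only the leading term at `x` survives.
  rw [← finsum_sub_distrib (hfin _ _ _) (hfin _ _ _), finsum_eq_single _ x] at h2
  · rw [← mul_sub] at h2
    simp only [ha, sub_sub_cancel_left] at h2
    rw [neg_div_pow_div_pow s₂, neg_div_pow_div_pow s₂] at h2
    have h3 : -((s₁ : ℚ) * p ^ (m * r) / p ^ i) / p ^ (m * r) = -(s₁ : ℚ) / p ^ i := by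
      field_simp
    rw [h3] at h2
    have h4 := sub_eq_zero.1 ((mul_eq_zero.1 h2).resolve_left hx)
    rw [add_comm (m * r), add_comm (m * r)] at h4
    exact h4
  · intro y hy
    rw [hterm r le_rfl y (Or.inr hy), sub_self]

theorem diagonal_hasPeriodAfter_and_row_eventuallyPeriodic [Finite F] {he : Monotone e}
    [CharP F p] (hs₁ : s₁ < p) (hs₂ : s₂ < p)
    (hf : ∀ γ ∈ f.support, ∃ i j : ℕ, 0 < i ∧ 0 < j ∧ γ = e (negExp p s₁ s₂ i j))
    (hfa : IsAlgebraic (fracField F e he) f) :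
    (∃ M N : ℕ, 0 < M ∧ 0 < N ∧ ∀ i₀ j₀ : ℕ, 0 < i₀ → 0 < j₀ →
      HasPeriodAfter (fun n => f.coeff (e (negExp p s₁ s₂ (i₀ + n) (j₀ + n)))) N M) ∧
    ∀ i : ℕ, 0 < i → EventuallyPeriodic fun n => f.coeff (e (negExp p s₁ s₂ i n)) := by
  have := Fintype.ofFinite F
  obtain ⟨m, hpp, hcard⟩ := FiniteField.card F p
  have : Fact p.Prime := ⟨hpp⟩
  have hm : ∀ c : F, c ^ p ^ (m : ℕ) = c := fun c => by rw [← hcard, FiniteField.pow_card]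
  obtain ⟨r, A, hA, hfin, hrel⟩ := exists_coeff_relation p hm hfa
  constructor
  · obtain ⟨M, N, hN, h⟩ := exists_hasPeriodAfter_of_determined F (m * r)
    refine ⟨M + 1, N, M.succ_pos, hN, fun i₀ j₀ hi₀ hj₀ n hn => ?_⟩
    refine h (fun n => f.coeff (e (negExp p s₁ s₂ (i₀ + n) (j₀ + n)))) (fun n n' hw => ?_) n
      (by omega)
    simp only [← add_assoc] at hw ⊢
    exact diagonal_determined m.pos hs₁ hs₂ hf hA hrel (by omega) (by omega) (by omega) (by omega) hw
  · intro i hi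
    -- A state is a column cut to rows `1, …, m * r + i`: enough rows to contain row `i` and to meet
    -- the bound `m * r ≤ I`. Indices shift by one because rows and columns start at `1`.
    obtain ⟨M, N, hN, h⟩ := exists_hasPeriodAfter_of_determined (Fin (m * r + i) → F) (m * r)
    have hper := h (fun n k => f.coeff (e (negExp p s₁ s₂ (k + 1) (n + 1)))) (fun n n' hw => by
      ext k
      have := row_determined (I := m * r + i) (j := n + 1) (j' := n' + 1) m.pos hs₁ hs₂ hf hA hfin
        hrel (by omega) (by omega) (by omega) (fun t ht l hl hl' => by
          have := congrFun (hw t ht) ⟨l - 1, by omega⟩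
          simp only [Nat.sub_add_cancel hl] at this
          rw [add_right_comm n, add_right_comm n', this]) (k + 1) (by omega) (by omega)
      rwa [add_right_comm n, add_right_comm n'])
    refine ⟨N, M + 1, hN, fun n hn => ?_⟩
    have := congrFun (hper (n - 1) (by omega)) ⟨i - 1, by omega⟩
    simp only [Nat.sub_add_cancel hi] at this
    rwa [show n - 1 + N + 1 = n + N by omega, show n - 1 + 1 = n by omega] at this

end Forward

/-! ### Exchange of the two variables -/

section Swap

variable {Γ : Type*} [AddCommGroup Γ] [LinearOrder Γ] {F : Type*} [Field F]

/-- The exponent isomorphism with the roles of the two variables exchanged. -/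
def swapExp (e : ℚ × ℚ ≃+ Γ) : ℚ × ℚ ≃+ Γ := AddEquiv.prodComm.trans e

omit [LinearOrder Γ] in
theorem swapExp_apply (e : ℚ × ℚ ≃+ Γ) (a b : ℚ) : swapExp e (a, b) = e (b, a) := rfl

theorem monotone_swapExp {e : ℚ × ℚ ≃+ Γ} (he : Monotone e) : Monotone (swapExp e) :=
  fun _ _ h => he ⟨h.2, h.1⟩

omit [LinearOrder Γ] in
theorem expo_swapExp (e : ℚ × ℚ ≃+ Γ) (x : Fin 2 →₀ ℕ) :
    expo (swapExp e) x = expo e (x.equivMapDomain (Equiv.swap 0 1)) := by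
  simp [expo, swapExp_apply, Finsupp.equivMapDomain_apply]

theorem exists_ofMv_swapExp_eq (e : ℚ × ℚ ≃+ Γ) (he : Monotone e) (φ : MvPowerSeries (Fin 2) F) :
    ∃ ψ, ofMv (swapExp e) (monotone_swapExp he) ψ = ofMv e he φ := by
  obtain ⟨ψ, hψ⟩ : ∃ ψ : MvPowerSeries (Fin 2) F, ∀ x, MvPowerSeries.coeff x ψ =
      MvPowerSeries.coeff (x.equivMapDomain (Equiv.swap 0 1)) φ :=
    ⟨fun x => MvPowerSeries.coeff (x.equivMapDomain (Equiv.swap 0 1)) φ, fun _ => rfl⟩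
  refine ⟨ψ, ?_⟩
  ext γ
  by_cases h : ∃ x, expo (swapExp e) x = γ
  · obtain ⟨x, rfl⟩ := h
    rw [coeff_ofMv_expo, expo_swapExp, coeff_ofMv_expo, hψ]
  · rw [coeff_ofMv_of_not _ _ _ h, coeff_ofMv_of_not]
    rintro ⟨x, rfl⟩
    refine h ⟨x.equivMapDomain (Equiv.swap 0 1), ?_⟩
    rw [expo_swapExp, ← Finsupp.equivMapDomain_trans]
    congr 1
    ext t
    simp

theorem fracField_swapExp [IsOrderedAddMonoid Γ] (e : ℚ × ℚ ≃+ Γ) (he : Monotone e) :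
    fracField F (swapExp e) (monotone_swapExp he) = fracField F e he := by
  refine congrArg Subfield.closure (Set.Subset.antisymm ?_ ?_)
  · rintro _ ⟨φ, rfl⟩
    exact exists_ofMv_swapExp_eq (swapExp e) (monotone_swapExp he) φ
  · rintro _ ⟨φ, rfl⟩
    exact exists_ofMv_swapExp_eq e he φ

end Swap

/-! ### Periodic coefficients give algebraic series -/

section Algebraic

variable {Γ : Type*} [AddCommGroup Γ] [LinearOrder Γ] [IsOrderedAddMonoid Γ]
  {F : Type*} [Field F] {e : ℚ × ℚ ≃+ Γ} {he : Monotone e}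

theorem isAlgebraic_of_pow_sub {K L : Type*} [Field K] [CommRing L] [Algebra K L] {q : ℕ}
    (hq : 1 < q) {f : L} (h : IsAlgebraic K (f ^ q - f)) : IsAlgebraic K f := by
  have hmonic : (Polynomial.X ^ q - Polynomial.X : Polynomial K).Monic :=
    Polynomial.monic_X_pow_sub (by simpa using hq)
  refine (IsIntegral.of_aeval_monic hmonic ?_ ?_).isAlgebraic
  · rw [FiniteField.X_pow_card_sub_X_natDegree_eq K hq]
    omega
  · simpa using h.isIntegral

theorem single_nat_mem_fracField (a b : ℕ) (c : F) :
    HahnSeries.single (e ((a : ℚ), (b : ℚ))) c ∈ fracField F e he := by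
  classical
  refine Subfield.subset_closure ⟨MvPowerSeries.monomial
    (Finsupp.single 0 a + Finsupp.single 1 b) c, ?_⟩
  have hx : expo e (Finsupp.single 0 a + Finsupp.single 1 b) = e ((a : ℚ), (b : ℚ)) := by
    simp [expo]
  change ofMv e he _ = _
  ext γ
  by_cases h : ∃ x, expo e x = γ
  · obtain ⟨x, rfl⟩ := h
    rw [coeff_ofMv_expo, MvPowerSeries.coeff_monomial, HahnSeries.coeff_single, ← hx]
    simp only [(expo_injective e).eq_iff]
  · rw [coeff_ofMv_of_not _ _ _ h, HahnSeries.coeff_single_of_ne]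
    rintro rfl
    exact h ⟨_, hx⟩

theorem single_int_mem_fracField (a b : ℤ) (c : F) :
    HahnSeries.single (e ((a : ℚ), (b : ℚ))) c ∈ fracField F e he := by
  have h1 := single_nat_mem_fracField (e := e) (he := he) a.toNat b.toNat c
  have h2 := single_nat_mem_fracField (e := e) (he := he) (-a).toNat (-b).toNat (1 : F)
  have h3 : HahnSeries.single (e ((a : ℚ), (b : ℚ))) c =
      HahnSeries.single (e ((a.toNat : ℚ), (b.toNat : ℚ))) c /
        HahnSeries.single (e (((-a).toNat : ℚ), ((-b).toNat : ℚ))) (1 : F) := by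
    rw [eq_div_iff (HahnSeries.single_ne_zero one_ne_zero), HahnSeries.single_mul_single, mul_one,
      ← map_add, Prod.mk_add_mk]
    have h (c : ℤ) : (c : ℚ) + ((-c).toNat : ℚ) = (c.toNat : ℚ) := by
      have : c + (-c).toNat = c.toNat := by omega
      exact_mod_cast this
    rw [h, h]
  rw [h3]
  exact div_mem h1 h2

/-- Clearing the denominators of both exponents by a power lands on a monomial with integer
exponents, which lies in the base field. -/
theorem isAlgebraic_single (γ : Γ) (c : F) :
    IsAlgebraic (fracField F e he) (HahnSeries.single γ c) := by
  obtain ⟨⟨a, b⟩, rfl⟩ := e.surjective γ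
  refine IsAlgebraic.of_pow (n := a.den * b.den) (Nat.mul_pos a.den_pos b.den_pos) ?_
  rw [HahnSeries.single_pow, ← map_nsmul]
  have h : (a.den * b.den) • (a, b) = (((a.num * b.den : ℤ) : ℚ), ((b.num * a.den : ℤ) : ℚ)) := by
    ext
    · simp only [Prod.smul_mk, nsmul_eq_mul]
      push_cast
      rw [← Rat.mul_den_eq_num a]
      ring
    · simp only [Prod.smul_mk, nsmul_eq_mul]
      push_cast
      rw [← Rat.mul_den_eq_num b]
      ring
  rw [h]
  exact isAlgebraic_algebraMap
    (⟨_, single_int_mem_fracField _ _ _⟩ : fracField F e he)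

theorem isAlgebraic_restrict_of_finite {S : Set Γ} (hS : S.Finite) (f : HahnSeries Γ F) :
    IsAlgebraic (fracField F e he) (restrict S f) := by
  lift S to Finset Γ using hS
  rw [restrict_finset]
  exact (IsIntegral.sum _ fun γ _ => (isAlgebraic_single γ _).isIntegral).isAlgebraic

theorem isAlgebraic_of_finite_support {f : HahnSeries Γ F} (hf : f.support.Finite) :
    IsAlgebraic (fracField F e he) f := by
  rw [← restrict_eq_self (subset_refl f.support)]
  exact isAlgebraic_restrict_of_finite hf f

/-- The set of exponents whose first component is `a`. -/
def row (e : ℚ × ℚ ≃+ Γ) (a : ℚ) : Set Γ := {γ | (e.symm γ).1 = a}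

omit [LinearOrder Γ] [IsOrderedAddMonoid Γ] in
theorem apply_mem_row {a a' b : ℚ} : e (a', b) ∈ row e a ↔ a' = a := by simp [row]

/-- The set of exponents whose second component is `b`. -/
def col (e : ℚ × ℚ ≃+ Γ) (b : ℚ) : Set Γ := {γ | (e.symm γ).2 = b}

omit [IsOrderedAddMonoid Γ] in
theorem ext_coeff_apply (e : ℚ × ℚ ≃+ Γ) {f g : HahnSeries Γ F}
    (h : ∀ a b, f.coeff (e (a, b)) = g.coeff (e (a, b))) : f = g := by
  ext γ
  obtain ⟨⟨a, b⟩, rfl⟩ := e.surjective γ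
  exact h a b

theorem isAlgebraic_restrict_biUnion_row {f : HahnSeries Γ F}
    (h : ∀ a, IsAlgebraic (fracField F e he) (restrict (row e a) f)) (A : Finset ℚ) :
    IsAlgebraic (fracField F e he) (restrict {γ | (e.symm γ).1 ∈ A} f) := by
  classical
  induction A using Finset.induction_on with
  | empty => exact isAlgebraic_restrict_of_finite (by simp) f
  | insert a A ha ih =>
    have h1 : {γ | (e.symm γ).1 ∈ insert a A} = row e a ∪ {γ | (e.symm γ).1 ∈ A} := by
      ext γ; simp [row]
    have h2 : row e a ∩ {γ | (e.symm γ).1 ∈ A} = ∅ := by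
      ext γ
      simp only [row, Set.mem_inter_iff, Set.mem_ofPred_eq, Set.mem_empty_iff_false, iff_false,
        not_and]
      rintro rfl
      exact ha
    rw [h1, restrict_union, h2]
    exact ((h a).add ih).sub (isAlgebraic_restrict_of_finite Set.finite_empty f)

/-- A series supported in finitely many rows and columns is algebraic if its rows and columns
are. -/
theorem isAlgebraic_of_rows_of_cols {f : HahnSeries Γ F}
    (hrow : ∀ a, IsAlgebraic (fracField F e he) (restrict (row e a) f))
    (hcol : ∀ b, IsAlgebraic (fracField F e he) (restrict (col e b) f)) (A B : Finset ℚ)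
    (hf : ∀ a b, f.coeff (e (a, b)) ≠ 0 → a ∈ A ∨ b ∈ B) :
    IsAlgebraic (fracField F e he) f := by
  have h1 : f.support ⊆ {γ | (e.symm γ).1 ∈ A} ∪ {γ | (e.symm γ).2 ∈ B} := by
    intro γ hγ
    obtain ⟨⟨a, b⟩, rfl⟩ := e.surjective γ
    simpa using hf a b hγ
  rw [← restrict_eq_self h1, restrict_union]
  -- By inclusion–exclusion, the overlap of the rows with the columns lies in the finite grid `A ×
  -- B`.
  refine ((isAlgebraic_restrict_biUnion_row hrow A).add ?_).sub (isAlgebraic_restrict_of_finite ?_ f)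
  · have h2 := isAlgebraic_restrict_biUnion_row (e := swapExp e) (he := monotone_swapExp he)
      (f := f) (fun b => by rw [fracField_swapExp]; exact hcol b) B
    rwa [fracField_swapExp] at h2
  · refine ((A.finite_toSet.prod B.finite_toSet).preimage e.symm.injective.injOn).subset ?_
    rintro γ ⟨h, h'⟩
    exact ⟨h, h'⟩

theorem neg_div_pow_eq_add (s p i l : ℕ) (hp : 0 < p) :
    -(s : ℚ) / p ^ i = -(s : ℚ) * p ^ l / p ^ (i + l) := by
  have : (p : ℚ) ≠ 0 := by positivity
  rw [pow_add]
  field_simp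

theorem neg_mul_pow_div_pow_div (s p i l : ℕ) (hp : 0 < p) :
    -(s : ℚ) * p ^ l / p ^ i / p ^ l = -(s : ℚ) / p ^ i := by
  have : (p : ℚ) ≠ 0 := by positivity
  field_simp

variable {p s₁ s₂ : ℕ} {f : HahnSeries Γ F}

theorem isAlgebraic_restrict_row [Fact p.Prime] [CharP F p] {m : ℕ} (hm0 : 0 < m)
    (hm : ∀ (k : ℕ) (c : F), c ^ p ^ (m * k) = c)
    (hf : ∀ γ ∈ f.support, ∃ i j : ℕ, 0 < i ∧ 0 < j ∧ γ = e (negExp p s₁ s₂ i j))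
    (h : ∀ i : ℕ, 0 < i → EventuallyPeriodic fun n => f.coeff (e (negExp p s₁ s₂ i n))) (a : ℚ) :
    IsAlgebraic (fracField F e he) (restrict (row e a) f) := by
  have hp : 0 < p := (Fact.out : p.Prime).pos
  by_cases ha : ∃ i : ℕ, 0 < i ∧ a = -(s₁ : ℚ) / p ^ i
  swap
  · rw [show restrict (row e a) f = 0 from ?_]
    · exact isAlgebraic_zero
    · refine ext_coeff_apply e fun a' b => ?_
      by_cases ha' : a' = a
      · rw [coeff_restrict_of_mem f (apply_mem_row.2 ha'), HahnSeries.coeff_zero]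
        by_contra h0
        obtain ⟨i, j, hi, -, hi', -⟩ := exists_negExp_of_coeff_ne_zero hf h0
        exact ha ⟨i, hi, ha' ▸ hi'⟩
      · rw [coeff_restrict_of_notMem f (mt apply_mem_row.1 ha'), HahnSeries.coeff_zero]
  obtain ⟨i, hi, hai⟩ := ha
  obtain ⟨N, M, hN, hper⟩ := h i hi
  set l := m * N with hl
  have hl0 : 0 < l := Nat.mul_pos hm0 hN
  have hperl : HasPeriodAfter (fun n => f.coeff (e (negExp p s₁ s₂ i n))) l M := by
    rw [hl, mul_comm]; exact hper.mul m
  -- The monomial moves the row to first exponent `0`, which Frobenius fixes, so the row can be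
  -- compared with its own `p ^ l`-th power.
  have hmul : IsAlgebraic (fracField F e he)
      (HahnSeries.single (e (-a, 0)) 1 * restrict (row e a) f) := by
    refine isAlgebraic_of_pow_sub (q := p ^ l)
      (Nat.one_lt_pow hl0.ne' (Fact.out : p.Prime).one_lt) ?_
    refine isAlgebraic_of_finite_support ?_
    -- At index `j > M + l` the coefficient of the difference compares the row at `j` and `j - l`,
    -- both beyond the preperiod, and vanishes.
    have hfin : ((fun j : ℕ => e (0, -(s₂ : ℚ) * p ^ l / p ^ j)) '' Set.Iic (M + l)).Finite :=
      (Set.finite_Iic _).image _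
    refine hfin.subset ?_
    intro γ hγ
    obtain ⟨⟨a', b⟩, rfl⟩ := e.surjective γ
    have hcoeff : ∀ a' b : ℚ, (HahnSeries.single (e (-a, 0)) 1 * restrict (row e a) f).coeff
        (e (a', b)) = if a' = 0 then f.coeff (e (a, b)) else 0 := by
      intro a' b
      rw [HahnSeries.coeff_single_mul, one_mul, ← map_sub, Prod.mk_sub_mk, sub_neg_eq_add, sub_zero]
      split_ifs with h0
      · rw [h0, zero_add, coeff_restrict_of_mem f (apply_mem_row.2 rfl)]
      · rw [coeff_restrict_of_notMem f]
        rw [apply_mem_row]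
        simpa using h0
    rw [HahnSeries.mem_support, HahnSeries.coeff_sub, coeff_pow_char_pow_apply, hm, hcoeff,
      hcoeff] at hγ
    have hpl : (p : ℚ) ^ l ≠ 0 := by positivity
    by_cases ha' : a' = 0
    swap
    · simp [ha', hpl] at hγ
    rw [ha', zero_div, if_pos rfl, if_pos rfl] at hγ
    have hb : ∃ j : ℕ, b = -(s₂ : ℚ) * p ^ l / p ^ j := by
      by_cases h0 : f.coeff (e (a, b)) = 0
      · rw [h0, sub_zero] at hγ
        obtain ⟨-, j, -, -, -, hj⟩ := exists_negExp_of_coeff_ne_zero hf hγ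
        refine ⟨j, ?_⟩
        rw [div_eq_iff hpl] at hj
        rw [hj]; ring
      · obtain ⟨-, j, -, -, -, hj⟩ := exists_negExp_of_coeff_ne_zero hf h0
        exact ⟨j + l, by rw [hj, ← neg_div_pow_eq_add s₂ p j l hp]⟩
    obtain ⟨j, rfl⟩ := hb
    refine ⟨j, ?_, by rw [ha']⟩
    rw [Set.mem_Iic]
    by_contra hj
    obtain ⟨t, rfl⟩ : ∃ t, j = t + l := ⟨j - l, by omega⟩
    rw [neg_mul_pow_div_pow_div s₂ p (t + l) l hp, ← neg_div_pow_eq_add s₂ p t l hp, hai] at hγ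
    exact hγ (sub_eq_zero.2 (hperl t (by omega)))
  have heq : restrict (row e a) f = HahnSeries.single (e (a, 0)) 1 *
      (HahnSeries.single (e (-a, 0)) 1 * restrict (row e a) f) := by
    rw [← mul_assoc, HahnSeries.single_mul_single, ← map_add, Prod.mk_add_mk, add_neg_cancel,
      add_zero, mul_one, Prod.mk_zero_zero, map_zero]
    exact (one_mul _).symm
  rw [heq]
  exact (isAlgebraic_single _ _).mul hmul

omit [IsOrderedAddMonoid Γ] in
theorem support_subset_swapExp
    (hf : ∀ γ ∈ f.support, ∃ i j : ℕ, 0 < i ∧ 0 < j ∧ γ = e (negExp p s₁ s₂ i j)) :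
    ∀ γ ∈ f.support, ∃ i j : ℕ, 0 < i ∧ 0 < j ∧ γ = swapExp e (negExp p s₂ s₁ i j) := by
  intro γ hγ
  obtain ⟨i, j, hi, hj, rfl⟩ := hf γ hγ
  exact ⟨j, i, hj, hi, rfl⟩

/-- Frobenius carries row `a / p ^ l` onto row `a`. Hence the rows of `f ^ p ^ l - f` are algebraic
once those of `f` are. -/
theorem restrict_row_pow_sub [Fact p.Prime] [CharP F p] {l : ℕ} (hl : ∀ c : F, c ^ p ^ l = c)
    (f : HahnSeries Γ F) (a : ℚ) :
    restrict (row e a) (f ^ p ^ l - f) =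
      restrict (row e (a / p ^ l)) f ^ p ^ l - restrict (row e a) f := by
  have hpl : (p : ℚ) ^ l ≠ 0 := by
    have := (Fact.out : p.Prime).pos
    positivity
  refine ext_coeff_apply e fun a' b => ?_
  rw [HahnSeries.coeff_sub, coeff_pow_char_pow_apply, hl, coeff_restrict, coeff_restrict,
    coeff_restrict, HahnSeries.coeff_sub, coeff_pow_char_pow_apply, hl]
  simp only [apply_mem_row, div_left_inj' hpl]
  split_ifs <;> simp

/-- A series satisfying the periodicity conditions is algebraic. -/
theorem isAlgebraic_of_periodic [Finite F] [CharP F p]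
    (hf : ∀ γ ∈ f.support, ∃ i j : ℕ, 0 < i ∧ 0 < j ∧ γ = e (negExp p s₁ s₂ i j))
    {M N : ℕ} (hN : 0 < N)
    (hdiag : ∀ i₀ j₀ : ℕ, 0 < i₀ → 0 < j₀ →
      HasPeriodAfter (fun n => f.coeff (e (negExp p s₁ s₂ (i₀ + n) (j₀ + n)))) N M)
    (hrow : ∀ i : ℕ, 0 < i → EventuallyPeriodic fun n => f.coeff (e (negExp p s₁ s₂ i n)))
    (hcol : ∀ j : ℕ, 0 < j → EventuallyPeriodic fun n => f.coeff (e (negExp p s₁ s₂ n j))) :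
    IsAlgebraic (fracField F e he) f := by
  classical
  have := Fintype.ofFinite F
  obtain ⟨m, hpp, hcard⟩ := FiniteField.card F p
  have : Fact p.Prime := ⟨hpp⟩
  have hp : 0 < p := hpp.pos
  have hm : ∀ (k : ℕ) (c : F), c ^ p ^ ((m : ℕ) * k) = c := fun k c => by
    rw [pow_mul, ← hcard, FiniteField.pow_card_pow]
  have hrow' := isAlgebraic_restrict_row (he := he) m.pos hm hf hrow
  have hcol' : ∀ b, IsAlgebraic (fracField F e he) (restrict (col e b) f) := by
    intro b
    rw [← fracField_swapExp]
    exact isAlgebraic_restrict_row (e := swapExp e) m.pos hm (support_subset_swapExp hf) hcol b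
  set l := (m : ℕ) * N with hl
  have hl0 : 0 < l := Nat.mul_pos m.pos hN
  have hpl : (p : ℚ) ^ l ≠ 0 := by positivity
  refine isAlgebraic_of_pow_sub (q := p ^ l) (Nat.one_lt_pow hl0.ne' hpp.one_lt) ?_
  refine isAlgebraic_of_rows_of_cols (fun a => ?_) (fun b => ?_)
    ((Finset.range (M + l + 1)).image fun i : ℕ => -(s₁ : ℚ) * p ^ l / p ^ i)
    ((Finset.range (M + l + 1)).image fun j : ℕ => -(s₂ : ℚ) * p ^ l / p ^ j) fun a b hab => ?_
  · rw [restrict_row_pow_sub (hm N)]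
    exact ((hrow' _).pow _).sub (hrow' _)
  · change IsAlgebraic _ (restrict (row (swapExp e) b) _)
    rw [restrict_row_pow_sub (hm N)]
    exact ((hcol' _).pow _).sub (hcol' _)
  rw [HahnSeries.coeff_sub, coeff_pow_char_pow_apply, hm] at hab
  obtain ⟨i, j, rfl, rfl⟩ : ∃ i j : ℕ, a = -(s₁ : ℚ) * p ^ l / p ^ i ∧
      b = -(s₂ : ℚ) * p ^ l / p ^ j := by
    by_cases h0 : f.coeff (e (a, b)) = 0
    · rw [h0, sub_zero] at hab
      obtain ⟨i, j, -, -, hi, hj⟩ := exists_negExp_of_coeff_ne_zero hf hab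
      rw [div_eq_iff hpl] at hi hj
      exact ⟨i, j, by rw [hi]; ring, by rw [hj]; ring⟩
    · obtain ⟨i, j, -, -, hi, hj⟩ := exists_negExp_of_coeff_ne_zero hf h0
      exact ⟨i + l, j + l, by rw [hi, ← neg_div_pow_eq_add s₁ p i l hp],
        by rw [hj, ← neg_div_pow_eq_add s₂ p j l hp]⟩
  by_contra hij
  rw [not_or] at hij
  have hi : M + l < i := by
    by_contra hi
    exact hij.1 (Finset.mem_image_of_mem _ (Finset.mem_range.2 (by omega)))
  have hj : M + l < j := by
    by_contra hj
    exact hij.2 (Finset.mem_image_of_mem _ (Finset.mem_range.2 (by omega)))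
  -- Going back by `l` leaves `t + 1 + M`: a positive starting index plus the preperiod, where
  -- diagonal periodicity applies.
  obtain ⟨i, rfl⟩ : ∃ t, i = t + 1 + M + l := ⟨i - 1 - M - l, by omega⟩
  obtain ⟨j, rfl⟩ : ∃ t, j = t + 1 + M + l := ⟨j - 1 - M - l, by omega⟩
  rw [neg_mul_pow_div_pow_div s₁ p _ l hp, ← neg_div_pow_eq_add s₁ p _ l hp,
    neg_mul_pow_div_pow_div s₂ p _ l hp, ← neg_div_pow_eq_add s₂ p _ l hp] at hab
  refine hab (sub_eq_zero.2 ?_)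
  have := ((hdiag (i + 1) (j + 1) i.succ_pos j.succ_pos).mul m) M le_rfl
  simp only [mul_comm N, ← hl, ← add_assoc] at this
  exact this

end Algebraic

end TwoVar

theorem corollary3p5 {F : Type*} [Field F] [Finite F] (p : ℕ) [CharP F p]
    {Γ : Type*} [AddCommGroup Γ] [LinearOrder Γ] [IsOrderedAddMonoid Γ]
    (e : ℚ × ℚ ≃+ Γ) (he : Monotone e)
    (s₁ s₂ : ℕ) (hs₁ : s₁ < p) (hs₂ : s₂ < p) (f : HahnSeries Γ F)
    (hf : ∀ γ ∈ f.support, ∃ i j : ℕ, 0 < i ∧ 0 < j ∧ γ = e (TwoVar.negExp p s₁ s₂ i j)) :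
    IsAlgebraic (TwoVar.fracField F e he) f ↔
      (∃ M N : ℕ, 0 < M ∧ 0 < N ∧ ∀ i₀ j₀ : ℕ, 0 < i₀ → 0 < j₀ →
        TwoVar.HasPeriodAfter
          (fun n => f.coeff (e (TwoVar.negExp p s₁ s₂ (i₀ + n) (j₀ + n)))) N M) ∧
      (∀ i : ℕ, 0 < i →
        TwoVar.EventuallyPeriodic (fun n => f.coeff (e (TwoVar.negExp p s₁ s₂ i n)))) ∧
      (∀ j : ℕ, 0 < j →
        TwoVar.EventuallyPeriodic (fun n => f.coeff (e (TwoVar.negExp p s₁ s₂ n j)))) := by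
  constructor
  · intro hfa
    obtain ⟨hdiag, hrow⟩ :=
      TwoVar.diagonal_hasPeriodAfter_and_row_eventuallyPeriodic hs₁ hs₂ hf hfa
    rw [← TwoVar.fracField_swapExp] at hfa
    exact ⟨hdiag, hrow, (TwoVar.diagonal_hasPeriodAfter_and_row_eventuallyPeriodic hs₂ hs₁
      (TwoVar.support_subset_swapExp hf) hfa).2⟩
  · rintro ⟨⟨M, N, -, hN, hdiag⟩, hrow, hcol⟩
    exact TwoVar.isAlgebraic_of_periodic hf hN hdiag hrow hcol
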